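/- Let $\mathbb{G}$ be an algebraic quantum group, i.e. a multiplier Hopf $*$-algebra $\mathcal{O}_c(\mathbb{G})$ over $\mathbb{C}$ (in the sense of Van Daele, with comultiplication $\Delta$ and antipode $S$) together with a nonzero positive left invariant functional $\varphi$ and a nonzero positive right invariant functional $\psi$. Let $\mathbb{H}\subset\mathbb{G}$ be an algebraic compact open quantum subgroup, i.e. a nonzero central projection $p_\mathbb{H}\in\mathcal{O}_c(\mathbb{G})$ with $\Delta(p_\mathbb{H})(1\otimes p_\mathbb{H})=p_\mathbb{H}\otimes p_\mathbb{H}$, and normalize $\varphi(p_\mathbb{H})=\psi(p_\mathbb{H})=1$. Put $$c_c(\mathbb{G}/\mathbb{H})=\{f\in\mathcal{O}_c(\mathbb{G}) \mid \Delta(f)(1\otimes p_\mathbb{H})=f\otimes p_\mathbb{H}\},$$ and let $\mathcal{H}(\mathbb{G},\mathbb{H})=c_c(\mathbb{H}\backslash\mathbb{G}/\mathbb{H})$ be the space of those $f\in c_c(\mathbb{G}/\mathbb{H})$ with $\Delta(f)(p_\mathbb{H}\otimes 1)=p_\mathbb{H}\otimes f$, equipped with the convolution product of $\mathcal{O}_c(\mathbb{G})$,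 $$f*g=(\varphi(\,\cdot\, f)\otimes\mathrm{id})(S^{-1}\otimes\mathrm{id})\Delta(g),$$ that is, the product transported along the Fourier transform $f\mapsto\varphi(\,\cdot\, f)$ from the dual $\mathcal{D}(\mathbb{G})=\{\varphi(\,\cdot\, b)\mid b\in\mathcal{O}_c(\mathbb{G})\}$ with product $(\omega\omega')(h)=(\omega\otimes\omega')\Delta(h)$. View $c_c(\mathbb{G}/\mathbb{H})$ as a right $\mathcal{D}(\mathbb{G})$-module via $a\cdot\omega=(\omega\otimes\mathrm{id})\Delta(a)$, and let $\mathrm{End}_\mathbb{G}(c_c(\mathbb{G}/\mathbb{H}))$ be the algebra, under composition, of $\mathcal{D}(\mathbb{G})$-linear endomorphisms of $c_c(\mathbb{G}/\mathbb{H})$. Then $\mathcal{H}(\mathbb{G},\mathbb{H})$ is closed under convolution and is an associative algebra with unit $p_\mathbb{H}$, and there are mutually inverse anti-multiplicative (unital) algebra isomorphisms $$T:\mathcal{H}(\mathbb{G},\mathbb{H})\to\mathrm{End}_\mathbb{G}(c_c(\mathbb{G}/\mathbb{H})),\quad T(f)(h)=h*f,\qquad T^{-1}:\mathrm{End}_\mathbb{G}(c_c(\mathbb{G}/\mathbb{H}))\to\mathcal{H}(\mathbb{G},\mathbb{H}),\quad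 T^{-1}(F)=F(p_\mathbb{H}).$$ Here anti-multiplicative means $T(f*g)=T(g)\circ T(f)$. -/

import Mathlib

open scoped TensorProduct ComplexOrder
open MulOpposite

namespace AlgQG

/-! ### Multipliers of an associative algebra without unit -/

section Multipliers

variable (B : Type*) [NonUnitalRing B] [Module ℂ B] [IsScalarTower ℂ B B] [SMulCommClass ℂ B B]

/-- The algebraic multiplier algebra `M(B)`: pairs `m = (L, R)` of linear maps of `B`, where
`L x = m x` and `R x = x m`, subject to `x (m y) = (x m) y`, `m (x y) = (m x) y` and
`(x y) m = x (y m)`. The product is the composition of multipliers, which explains the opposite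
algebra in the second component. -/
def multiplierSubalgebra : Subalgebra ℂ (Module.End ℂ B × (Module.End ℂ B)ᵐᵒᵖ) where
  carrier := {m | ∀ x y : B, x * m.1 y = m.2.unop x * y ∧ m.1 (x * y) = m.1 x * y ∧
    m.2.unop (x * y) = x * m.2.unop y}
  mul_mem' := by
    intro m n hm hn x y
    change x * m.1 (n.1 y) = n.2.unop (m.2.unop x) * y ∧
      m.1 (n.1 (x * y)) = m.1 (n.1 x) * y ∧
      n.2.unop (m.2.unop (x * y)) = x * n.2.unop (m.2.unop y)
    rw [(hm _ _).1, (hn _ _).1, (hn _ _).2.1, (hm _ _).2.1, (hm _ _).2.2, (hn _ _).2.2]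
    exact ⟨rfl, rfl, rfl⟩
  add_mem' := by
    intro m n hm hn x y
    change x * (m.1 y + n.1 y) = (m.2.unop x + n.2.unop x) * y ∧
      m.1 (x * y) + n.1 (x * y) = (m.1 x + n.1 x) * y ∧
      m.2.unop (x * y) + n.2.unop (x * y) = x * (m.2.unop y + n.2.unop y)
    rw [mul_add, add_mul, (hm _ _).1, (hn _ _).1, (hm _ _).2.1, (hn _ _).2.1, (hm _ _).2.2,
      (hn _ _).2.2, mul_add, add_mul]
    exact ⟨rfl, rfl, rfl⟩
  algebraMap_mem' := by
    intro r x y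
    change x * (r • y) = (r • x) * y ∧ r • (x * y) = (r • x) * y ∧ r • (x * y) = x * (r • y)
    rw [mul_smul_comm, smul_mul_assoc]
    exact ⟨rfl, rfl, rfl⟩

/-- The algebraic multiplier algebra as a type. -/
abbrev Multiplier : Type _ := multiplierSubalgebra B

variable {B}

namespace Multiplier

/-- `m.lact x = m x`. -/
def lact (m : Multiplier B) : B →ₗ[ℂ] B := m.1.1

/-- `m.ract x = x m`. -/
def ract (m : Multiplier B) : B →ₗ[ℂ] B := m.1.2.unop

theorem mul_lact (m : Multiplier B) (x y : B) : x * m.lact y = m.ract x * y := (m.2 x y).1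

theorem lact_mul_apply (m : Multiplier B) (x y : B) : m.lact (x * y) = m.lact x * y :=
  (m.2 x y).2.1

theorem ract_mul_apply (m : Multiplier B) (x y : B) : m.ract (x * y) = x * m.ract y :=
  (m.2 x y).2.2

@[simp] theorem lact_mul (m n : Multiplier B) (x : B) :
    (m * n).lact x = m.lact (n.lact x) := rfl

@[simp] theorem ract_mul (m n : Multiplier B) (x : B) :
    (m * n).ract x = n.ract (m.ract x) := rfl

theorem ext_acts {m n : Multiplier B} (h₁ : ∀ x, m.lact x = n.lact x)
    (h₂ : ∀ x, m.ract x = n.ract x) : m = n := by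
  apply Subtype.ext
  refine Prod.ext (LinearMap.ext h₁) ?_
  exact MulOpposite.unop_injective (LinearMap.ext h₂)

/-- The canonical map `B → M(B)`. -/
def of (b : B) : Multiplier B :=
  ⟨(LinearMap.mulLeft ℂ b, op (LinearMap.mulRight ℂ b)), fun x y =>
    ⟨(mul_assoc x b y).symm, (mul_assoc b x y).symm, mul_assoc x y b⟩⟩

@[simp] theorem lact_of (b x : B) : (of b).lact x = b * x := rfl

@[simp] theorem ract_of (b x : B) : (of b).ract x = x * b := rfl

theorem mul_of (m : Multiplier B) (b : B) : m * of b = of (m.lact b) := by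
  apply ext_acts
  · exact fun x => m.lact_mul_apply b x
  · exact fun x => (m.mul_lact x b).symm

theorem of_mul (b : B) (m : Multiplier B) : of b * m = of (m.ract b) := by
  apply ext_acts
  · exact fun x => m.mul_lact b x
  · exact fun x => m.ract_mul_apply x b

theorem of_add (a b : B) : of (a + b) = of a + of b := by
  apply ext_acts
  · exact fun x => add_mul a b x
  · exact fun x => mul_add x a b

theorem of_smul (r : ℂ) (b : B) : of (r • b) = r • of b := by
  apply ext_acts
  · exact fun x => smul_mul_assoc r b x
  · exact fun x => mul_smul_comm r x b

/-- The adjoint multiplier: `m* x = (x* m)*` and `x m* = (m x*)*`. -/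
noncomputable instance [StarRing B] [StarModule ℂ B] : Star (Multiplier B) where
  star m :=
    ⟨((starLinearEquiv ℂ (A := B)).toLinearMap ∘ₛₗ m.ract ∘ₛₗ
        (starLinearEquiv ℂ (A := B)).toLinearMap,
      op ((starLinearEquiv ℂ (A := B)).toLinearMap ∘ₛₗ m.lact ∘ₛₗ
        (starLinearEquiv ℂ (A := B)).toLinearMap)), by
      intro x y
      change x * star (m.ract (star y)) = star (m.lact (star x)) * y ∧
        star (m.ract (star (x * y))) = star (m.ract (star x)) * y ∧
        star (m.lact (star (x * y))) = x * star (m.lact (star y))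
      refine ⟨star_injective ?_, star_injective ?_, star_injective ?_⟩
      · rw [star_mul, star_mul, star_star, star_star]
        exact (m.mul_lact _ _).symm
      · rw [star_star, star_mul, star_mul, star_star, m.ract_mul_apply]
      · rw [star_star, star_mul, star_mul, star_star, m.lact_mul_apply]⟩

@[simp] theorem lact_star [StarRing B] [StarModule ℂ B] (m : Multiplier B) (x : B) :
    (star m).lact x = star (m.ract (star x)) := rfl

@[simp] theorem ract_star [StarRing B] [StarModule ℂ B] (m : Multiplier B) (x : B) :
    (star m).ract x = star (m.lact (star x)) := rfl

end Multiplier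

end Multipliers

section TensorMultipliers

variable {A : Type*} [NonUnitalRing A] [Module ℂ A] [IsScalarTower ℂ A A] [SMulCommClass ℂ A A]

/-- The multiplier `1 ⊗ b` of `A ⊗ A`. -/
noncomputable def oneTmul (b : A) : Multiplier (A ⊗[ℂ] A) :=
  ⟨((LinearMap.mulLeft ℂ b).lTensor A, op ((LinearMap.mulRight ℂ b).lTensor A)), by
    intro x y
    change x * (LinearMap.mulLeft ℂ b).lTensor A y = (LinearMap.mulRight ℂ b).lTensor A x * y ∧
      (LinearMap.mulLeft ℂ b).lTensor A (x * y) = (LinearMap.mulLeft ℂ b).lTensor A x * y ∧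
      (LinearMap.mulRight ℂ b).lTensor A (x * y) = x * (LinearMap.mulRight ℂ b).lTensor A y
    induction x using TensorProduct.induction_on with
    | zero => simp
    | add x₁ x₂ h₁ h₂ =>
      simp only [add_mul, map_add, h₁.1, h₂.1, h₁.2.1, h₂.2.1, h₁.2.2, h₂.2.2, and_self]
    | tmul u v =>
      induction y using TensorProduct.induction_on with
      | zero => simp
      | add y₁ y₂ h₁ h₂ =>
        simp only [mul_add, map_add, h₁.1, h₂.1, h₁.2.1, h₂.2.1, h₁.2.2, h₂.2.2, and_self]
      | tmul u' v' => simp [mul_assoc]⟩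

/-- The multiplier `a ⊗ 1` of `A ⊗ A`. -/
noncomputable def tmulOne (a : A) : Multiplier (A ⊗[ℂ] A) :=
  ⟨((LinearMap.mulLeft ℂ a).rTensor A, op ((LinearMap.mulRight ℂ a).rTensor A)), by
    intro x y
    change x * (LinearMap.mulLeft ℂ a).rTensor A y = (LinearMap.mulRight ℂ a).rTensor A x * y ∧
      (LinearMap.mulLeft ℂ a).rTensor A (x * y) = (LinearMap.mulLeft ℂ a).rTensor A x * y ∧
      (LinearMap.mulRight ℂ a).rTensor A (x * y) = x * (LinearMap.mulRight ℂ a).rTensor A y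
    induction x using TensorProduct.induction_on with
    | zero => simp
    | add x₁ x₂ h₁ h₂ =>
      simp only [add_mul, map_add, h₁.1, h₂.1, h₁.2.1, h₂.2.1, h₁.2.2, h₂.2.2, and_self]
    | tmul u v =>
      induction y using TensorProduct.induction_on with
      | zero => simp
      | add y₁ y₂ h₁ h₂ =>
        simp only [mul_add, map_add, h₁.1, h₂.1, h₁.2.1, h₂.2.1, h₁.2.2, h₂.2.2, and_self]
      | tmul u' v' => simp [mul_assoc]⟩

@[simp] theorem lact_oneTmul (b u v : A) :
    (oneTmul b).lact (u ⊗ₜ[ℂ] v) = u ⊗ₜ[ℂ] (b * v) := rfl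

@[simp] theorem ract_oneTmul (b u v : A) :
    (oneTmul b).ract (u ⊗ₜ[ℂ] v) = u ⊗ₜ[ℂ] (v * b) := rfl

@[simp] theorem lact_tmulOne (a u v : A) :
    (tmulOne a).lact (u ⊗ₜ[ℂ] v) = (a * u) ⊗ₜ[ℂ] v := rfl

@[simp] theorem ract_tmulOne (a u v : A) :
    (tmulOne a).ract (u ⊗ₜ[ℂ] v) = (u * a) ⊗ₜ[ℂ] v := rfl

end TensorMultipliers

section Slices

variable {A : Type*} [NonUnitalRing A] [Module ℂ A]

/-- `ω ⊗ id : A ⊗ A → A` for a linear functional `ω`. -/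
noncomputable def sliceLeft (ω : A →ₗ[ℂ] ℂ) : A ⊗[ℂ] A →ₗ[ℂ] A :=
  (TensorProduct.lid ℂ A).toLinearMap ∘ₗ ω.rTensor A

/-- `id ⊗ ω : A ⊗ A → A` for a linear functional `ω`. -/
noncomputable def sliceRight (ω : A →ₗ[ℂ] ℂ) : A ⊗[ℂ] A →ₗ[ℂ] A :=
  (TensorProduct.rid ℂ A).toLinearMap ∘ₗ ω.lTensor A

@[simp] theorem sliceLeft_tmul (ω : A →ₗ[ℂ] ℂ) (u v : A) :
    sliceLeft ω (u ⊗ₜ[ℂ] v) = ω u • v := by simp [sliceLeft]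

@[simp] theorem sliceRight_tmul (ω : A →ₗ[ℂ] ℂ) (u v : A) :
    sliceRight ω (u ⊗ₜ[ℂ] v) = ω v • u := by simp [sliceRight]

end Slices

/-! ### Multiplier Hopf `*`-algebras and algebraic quantum groups -/

/-- A multiplier Hopf `*`-algebra structure on a complex `*`-algebra `A`, possibly without unit:
the product of `A` is nondegenerate, the comultiplication `Δ : A → M(A ⊗ A)` is a
`*`-homomorphism, the elements `Δ(a)(1 ⊗ b)` and `(a ⊗ 1)Δ(b)` lie in `A ⊗ A`, the two linear
maps `a ⊗ b ↦ Δ(a)(1 ⊗ b)` and `a ⊗ b ↦ (a ⊗ 1)Δ(b)` of `A ⊗ A` are bijective, and `Δ` is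
coassociative. The two bijections are determined by `Δ` through `of_galR` and `of_galL`. -/
structure MultiplierHopfStarAlgebra (A : Type*) [NonUnitalRing A] [Module ℂ A]
    [IsScalarTower ℂ A A] [SMulCommClass ℂ A A] [StarRing A] [StarModule ℂ A] where
  eq_zero_of_mul_left : ∀ a : A, (∀ c, c * a = 0) → a = 0
  eq_zero_of_mul_right : ∀ a : A, (∀ c, a * c = 0) → a = 0
  /-- the comultiplication -/
  comul : A →ₙₐ[ℂ] Multiplier (A ⊗[ℂ] A)
  comul_star : ∀ a, comul (star a) = star (comul a)
  /-- `a ⊗ b ↦ Δ(a)(1 ⊗ b)` -/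
  galR : (A ⊗[ℂ] A) ≃ₗ[ℂ] (A ⊗[ℂ] A)
  of_galR : ∀ a b : A, Multiplier.of (galR (a ⊗ₜ b)) = comul a * oneTmul b
  /-- `a ⊗ b ↦ (a ⊗ 1)Δ(b)` -/
  galL : (A ⊗[ℂ] A) ≃ₗ[ℂ] (A ⊗[ℂ] A)
  of_galL : ∀ a b : A, Multiplier.of (galL (a ⊗ₜ b)) = tmulOne a * comul b
  /-- `(a ⊗ 1 ⊗ 1)(Δ ⊗ id)(Δ(b)(1 ⊗ c)) = (id ⊗ Δ)((a ⊗ 1)Δ(b))(1 ⊗ 1 ⊗ c)` -/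
  coassoc : ∀ a b c : A,
    TensorProduct.assoc ℂ A A A
        (galL.toLinearMap.rTensor A
          ((TensorProduct.assoc ℂ A A A).symm (a ⊗ₜ galR (b ⊗ₜ c)))) =
      galR.toLinearMap.lTensor A (TensorProduct.assoc ℂ A A A (galL (a ⊗ₜ b) ⊗ₜ c))

/-- An algebraic quantum group `𝔾` with `𝒪_c(𝔾) = A`: a multiplier Hopf `*`-algebra together with
a nonzero positive left invariant functional `φ` and a nonzero positive right invariant
functional `ψ`. Invariance, that is `(id ⊗ φ)Δ(a) = φ(a)1` and `(ψ ⊗ id)Δ(a) = ψ(a)1` in `M(A)`,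
is expressed by multiplying with an arbitrary `b ∈ A`. -/
structure AlgebraicQuantumGroup (A : Type*) [NonUnitalRing A] [Module ℂ A]
    [IsScalarTower ℂ A A] [SMulCommClass ℂ A A] [StarRing A] [StarModule ℂ A]
    extends MultiplierHopfStarAlgebra A where
  /-- the left Haar functional -/
  φ : A →ₗ[ℂ] ℂ
  φ_ne_zero : φ ≠ 0
  φ_nonneg : ∀ a, 0 ≤ φ (star a * a)
  φ_invariant : ∀ a b, sliceRight φ (galL (b ⊗ₜ a)) = φ a • b
  /-- the right Haar functional -/
  ψ : A →ₗ[ℂ] ℂ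
  ψ_ne_zero : ψ ≠ 0
  ψ_nonneg : ∀ a, 0 ≤ ψ (star a * a)
  ψ_invariant : ∀ a b, sliceLeft ψ (galR (a ⊗ₜ b)) = ψ a • b

variable {A : Type*} [NonUnitalRing A] [Module ℂ A] [IsScalarTower ℂ A A] [SMulCommClass ℂ A A]
  [StarRing A] [StarModule ℂ A]

namespace MultiplierHopfStarAlgebra

variable (G : MultiplierHopfStarAlgebra A)

/-- The bijection `a ⊗ b ↦ Δ(a)(b ⊗ 1) = ((b* ⊗ 1)Δ(a*))*` of `A ⊗ A`, see `of_galRL`. -/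
noncomputable def galRL : (A ⊗[ℂ] A) ≃ₗ[ℂ] (A ⊗[ℂ] A) :=
  ((starLinearEquiv ℂ (A := A ⊗[ℂ] A)).trans
    ((TensorProduct.comm ℂ A A).trans G.galL)).trans (starLinearEquiv ℂ (A := A ⊗[ℂ] A))

theorem galRL_tmul (a b : A) : G.galRL (a ⊗ₜ b) = star (G.galL (star b ⊗ₜ star a)) := rfl

theorem star_of (t : A ⊗[ℂ] A) : star (Multiplier.of t) = Multiplier.of (star t) := by
  apply Multiplier.ext_acts <;> intro x <;> simp

theorem star_tmulOne (a : A) : star (tmulOne a) = tmulOne (star a) := by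
  apply Multiplier.ext_acts <;> intro x <;>
  · induction x using TensorProduct.induction_on with
    | zero => simp only [map_zero]
    | add x₁ x₂ h₁ h₂ => rw [map_add, map_add, h₁, h₂]
    | tmul u v => simp

theorem star_mul' (m n : Multiplier (A ⊗[ℂ] A)) : star (m * n) = star n * star m := by
  apply Multiplier.ext_acts <;> intro x <;> simp

theorem of_galRL (a b : A) : Multiplier.of (G.galRL (a ⊗ₜ b)) = G.comul a * tmulOne b := by
  rw [galRL_tmul, ← star_of, G.of_galL, star_mul', star_tmulOne, ← G.comul_star, star_star,
    star_star]

theorem eq_zero_of_mulLeft_rTensor (G : MultiplierHopfStarAlgebra A) {V : Type*} [AddCommGroup V] [Module ℂ V] (w : A ⊗[ℂ] V)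
    (h : ∀ c : A, (LinearMap.mulLeft ℂ c).rTensor V w = 0) : w = 0 := by
  classical
  let e := TensorProduct.equivFinsuppOfBasisRight (M := A) (Module.Basis.ofVectorSpace ℂ V)
  have key : ∀ (c : A) (w : A ⊗[ℂ] V) (i), e ((LinearMap.mulLeft ℂ c).rTensor V w) i = c * e w i := by
    intro c w i
    induction w using TensorProduct.induction_on with
    | zero => simp
    | add x y hx hy => simp only [map_add, Finsupp.add_apply, mul_add, hx, hy]
    | tmul x y => simp [e, mul_smul_comm]
  apply e.injective
  rw [map_zero]
  ext i
  refine G.eq_zero_of_mul_left _ fun c => ?_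
  rw [← key, h c, map_zero, Finsupp.zero_apply]

/-- The tensor square of the algebra embeds into its multiplier algebra. -/
theorem of_injective (G : MultiplierHopfStarAlgebra A) :
    Function.Injective (Multiplier.of : A ⊗[ℂ] A → Multiplier (A ⊗[ℂ] A)) := by
  intro s t hst
  rw [← sub_eq_zero]
  have h : ∀ a b : A, (a ⊗ₜ[ℂ] b) * (s - t) = 0 := by
    intro a b
    have := congrArg (fun m => Multiplier.ract m (a ⊗ₜ[ℂ] b)) hst
    simp only [Multiplier.ract_of] at this
    rw [mul_sub, this, sub_self]
  apply G.eq_zero_of_mulLeft_rTensor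
  intro a
  apply (TensorProduct.comm ℂ A A).injective
  rw [map_zero]
  apply G.eq_zero_of_mulLeft_rTensor
  intro b
  have key : ∀ r : A ⊗[ℂ] A, (LinearMap.mulLeft ℂ b).rTensor A (TensorProduct.comm ℂ A A
      ((LinearMap.mulLeft ℂ a).rTensor A r)) = TensorProduct.comm ℂ A A ((a ⊗ₜ[ℂ] b) * r) := by
    intro r
    induction r using TensorProduct.induction_on with
    | zero => simp
    | add x y hx hy => simp only [map_add, mul_add, hx, hy]
    | tmul x y => simp
  rw [key, h, map_zero]

/-- `(c ⊗ 1)(Δ(a)(b ⊗ 1)) = ((c ⊗ 1)Δ(a))(b ⊗ 1)`. -/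
theorem tmulOne_lact_galRL (a b c : A) :
    (tmulOne c).lact (G.galRL (a ⊗ₜ b)) = (tmulOne b).ract (G.galL (c ⊗ₜ a)) := by
  apply G.of_injective
  have h₁ := G.of_galRL a b
  have h₂ := G.of_galL c a
  rw [← Multiplier.mul_of, ← Multiplier.of_mul, h₁, h₂, mul_assoc]

/-- `Δ(ha)(b ⊗ 1) = Δ(h)(Δ(a)(b ⊗ 1))`. -/
theorem galRL_mul (h a b : A) :
    G.galRL ((h * a) ⊗ₜ b) = (G.comul h).lact (G.galRL (a ⊗ₜ b)) := by
  apply G.of_injective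
  rw [← Multiplier.mul_of, G.of_galRL, G.of_galRL, map_mul, mul_assoc]

/-- `(Δ(a)(b ⊗ 1))(1 ⊗ c) = (Δ(a)(1 ⊗ c))(b ⊗ 1)`. -/
theorem oneTmul_ract_galRL (a b c : A) :
    (oneTmul c).ract (G.galRL (a ⊗ₜ b)) = (tmulOne b).ract (G.galR (a ⊗ₜ c)) := by
  apply G.of_injective
  have h : tmulOne b * oneTmul c = oneTmul c * tmulOne b := by
    apply Multiplier.ext_acts <;> intro x <;>
    · induction x using TensorProduct.induction_on with
      | zero => simp only [map_zero]
      | add x₁ x₂ h₁ h₂ => rw [map_add, map_add, h₁, h₂]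
      | tmul u v => simp
  rw [← Multiplier.of_mul, ← Multiplier.of_mul, G.of_galRL, G.of_galR, mul_assoc, mul_assoc, h]

end MultiplierHopfStarAlgebra

namespace AlgebraicQuantumGroup

variable (G : AlgebraicQuantumGroup A)

/-- The Fourier transform `𝓕(f) = φ(· f)`. Its range `{φ(· f) | f ∈ A}` is the dual multiplier Hopf
algebra `𝒟(𝔾)`, with product `(ωω', h) = (ω ⊗ ω', Δ(h))`. -/
def fourier (f : A) : A →ₗ[ℂ] ℂ := G.φ ∘ₗ LinearMap.mulRight ℂ f

/-- The convolution product `f * g = (fφ ⊗ id)(S⁻¹ ⊗ id)Δ(g)` of `A`, where `fφ = φ(· f)`, i.e.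
`f * g = φ(S⁻¹(g₍₁₎)f) g₍₂₎`. Here the antipode is expressed through the bijection
`x ⊗ y ↦ Δ(x)(y ⊗ 1)`, whose inverse sends `f ⊗ g` to `g₍₂₎ ⊗ S⁻¹(g₍₁₎)f`. Equivalently, this
is the product transported from `𝒟(𝔾)` by the Fourier transform, see `fourier_conv`. -/
noncomputable def conv (f g : A) : A := sliceRight G.φ (G.galRL.symm (f ⊗ₜ g))

/-- `(id ⊗ φ)(Δ(a)(b ⊗ 1)) = φ(a) b`. -/
theorem φ_invariant' (a b : A) : sliceRight G.φ (G.galRL (a ⊗ₜ b)) = G.φ a • b := by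
  rw [← sub_eq_zero]
  refine G.eq_zero_of_mul_left _ fun c => ?_
  have h₁ : ∀ t : A ⊗[ℂ] A, c * sliceRight G.φ t = sliceRight G.φ ((tmulOne c).lact t) := by
    intro t
    induction t using TensorProduct.induction_on with
    | zero => simp
    | add x y hx hy => simp only [map_add, mul_add, hx, hy]
    | tmul x y => simp [mul_smul_comm]
  have h₂ : ∀ t : A ⊗[ℂ] A, sliceRight G.φ ((tmulOne b).ract t) = sliceRight G.φ t * b := by
    intro t
    induction t using TensorProduct.induction_on with
    | zero => simp
    | add x y hx hy => simp only [map_add, add_mul, hx, hy]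
    | tmul x y => simp [smul_mul_assoc]
  have h₃ := G.tmulOne_lact_galRL a b c
  rw [mul_sub, h₁, h₃, h₂, G.φ_invariant, smul_mul_assoc, mul_smul_comm, sub_self]

/-- `(𝓕(f * g), h) = (𝓕(f) ⊗ 𝓕(g), Δ(h)) = (φ ⊗ φ)(Δ(h)(f ⊗ g))`. -/
theorem fourier_conv (f g h : A) :
    G.fourier (G.conv f g) h = G.φ (sliceRight G.φ ((G.comul h).lact (f ⊗ₜ g))) := by
  obtain ⟨t, ht⟩ := G.galRL.surjective (f ⊗ₜ[ℂ] g)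
  rw [conv, ← ht, LinearEquiv.symm_apply_apply]
  change G.φ (h * sliceRight G.φ t) = _
  clear ht
  induction t using TensorProduct.induction_on with
  | zero => simp
  | add x y hx hy => simp only [map_add, mul_add, hx, hy]
  | tmul x y =>
    rw [← G.galRL_mul, φ_invariant']
    simp [mul_smul_comm, mul_comm]

/-- The right action of `ω = φ(· b) ∈ 𝒟(𝔾)` on `A`: `a · ω = (ω ⊗ id)Δ(a) = (φ ⊗ id)(Δ(a)(b ⊗ 1))`.
It depends only on the functional `ω`, see `act_congr`. -/
noncomputable def act (b : A) : A →ₗ[ℂ] A :=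
  sliceLeft G.φ ∘ₗ G.galRL.toLinearMap ∘ₗ (TensorProduct.mk ℂ A A).flip b

/-- `((ω ⊗ id)Δ(a)) c = (ω ⊗ id)(Δ(a)(1 ⊗ c))` for `ω = φ(· b)`. -/
theorem act_mul (b a c : A) : G.act b a * c = sliceLeft (G.fourier b) (G.galR (a ⊗ₜ c)) := by
  have h₁ : ∀ t : A ⊗[ℂ] A, sliceLeft G.φ t * c = sliceLeft G.φ ((oneTmul c).ract t) := by
    intro t
    induction t using TensorProduct.induction_on with
    | zero => simp
    | add x y hx hy => simp only [map_add, add_mul, hx, hy]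
    | tmul x y => simp [smul_mul_assoc]
  have h₂ : ∀ t : A ⊗[ℂ] A, sliceLeft G.φ ((tmulOne b).ract t) = sliceLeft (G.fourier b) t := by
    intro t
    induction t using TensorProduct.induction_on with
    | zero => simp
    | add x y hx hy => simp only [map_add, hx, hy]
    | tmul x y => simp [fourier]
  change sliceLeft G.φ (G.galRL (a ⊗ₜ b)) * c = _
  rw [h₁, ← h₂, G.oneTmul_ract_galRL]

theorem act_congr {b b' : A} (h : G.fourier b = G.fourier b') : G.act b = G.act b' := by
  ext a
  rw [← sub_eq_zero]
  refine G.eq_zero_of_mul_right _ fun c => ?_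
  rw [sub_mul, act_mul, act_mul, h, sub_self]

/-- An algebraic compact open quantum subgroup `ℍ ⊂ 𝔾`: a nonzero central projection
`p = p_ℍ ∈ 𝒪_c(𝔾)` such that `Δ(p)(1 ⊗ p) = p ⊗ p`. -/
structure CompactOpenSubgroup where
  p : A
  p_ne_zero : p ≠ 0
  p_mul_p : p * p = p
  star_p : star p = p
  p_central : ∀ a, p * a = a * p
  comul_p : G.comul p * oneTmul p = Multiplier.of (p ⊗ₜ p)

variable {G}

namespace CompactOpenSubgroup

variable (H : G.CompactOpenSubgroup)

/-- `c_c(𝔾/ℍ) = {f ∈ 𝒪_c(𝔾) | Δ(f)(1 ⊗ p) = f ⊗ p}`. -/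
def cc : Submodule ℂ A where
  carrier := {f | G.comul f * oneTmul H.p = Multiplier.of (f ⊗ₜ H.p)}
  zero_mem' := by
    change G.comul 0 * _ = _
    rw [map_zero, zero_mul, TensorProduct.zero_tmul, ← zero_smul ℂ ((0 : A) ⊗ₜ[ℂ] (0 : A)),
      Multiplier.of_smul, zero_smul]
  add_mem' := by
    intro f g hf hg
    change G.comul (f + g) * _ = _
    rw [map_add, add_mul, hf, hg, TensorProduct.add_tmul, Multiplier.of_add]
  smul_mem' := by
    intro r f hf
    change G.comul (r • f) * _ = _
    rw [map_smul, smul_mul_assoc, hf, ← Multiplier.of_smul, TensorProduct.smul_tmul']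

/-- `c_c(ℍ\𝔾) = {f ∈ 𝒪_c(𝔾) | Δ(f)(p ⊗ 1) = p ⊗ f}`. -/
def ccLeft : Submodule ℂ A where
  carrier := {f | G.comul f * tmulOne H.p = Multiplier.of (H.p ⊗ₜ f)}
  zero_mem' := by
    change G.comul 0 * _ = _
    rw [map_zero, zero_mul, TensorProduct.tmul_zero, ← zero_smul ℂ ((0 : A) ⊗ₜ[ℂ] (0 : A)),
      Multiplier.of_smul, zero_smul]
  add_mem' := by
    intro f g hf hg
    change G.comul (f + g) * _ = _
    rw [map_add, add_mul, hf, hg, TensorProduct.tmul_add, Multiplier.of_add]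
  smul_mem' := by
    intro r f hf
    change G.comul (r • f) * _ = _
    rw [map_smul, smul_mul_assoc, hf, ← Multiplier.of_smul, TensorProduct.tmul_smul]

/-- The space `c_c(ℍ\𝔾/ℍ) = c_c(𝔾/ℍ) ∩ c_c(ℍ\𝔾)` underlying the Hecke algebra `ℋ(𝔾, ℍ)`, which
is also the space `c_c(𝔾/ℍ)^ℍ` of left `ℍ`-invariant elements of `c_c(𝔾/ℍ)`. The product of
`ℋ(𝔾, ℍ)` is the restriction of the convolution product `conv`. -/
def hecke : Submodule ℂ A := H.cc ⊓ H.ccLeft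

theorem p_mem_cc : H.p ∈ H.cc := H.comul_p

/-- `c_c(𝔾/ℍ)` is stable under the action of `𝒟(𝔾)`. -/
theorem act_mem_cc (b a : A) (ha : a ∈ H.cc) : G.act b a ∈ H.cc := by
  let K : A →ₗ[ℂ] A ⊗[ℂ] A :=
    G.galR.toLinearMap ∘ₗ (TensorProduct.mk ℂ A A).flip H.p - (TensorProduct.mk ℂ A A).flip H.p
  have hK : ∀ z, K z = G.galR (z ⊗ₜ H.p) - z ⊗ₜ H.p := fun z => rfl
  have hfix : G.galR (a ⊗ₜ H.p) = a ⊗ₜ H.p := G.of_injective ((G.of_galR a H.p).trans ha)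
  have hmem : ∀ z, K z = 0 → z ∈ H.cc := by
    intro z hz
    rw [hK, sub_eq_zero] at hz
    change G.comul z * oneTmul H.p = _
    rw [← G.of_galR, hz]
  have hu : ∀ c, K.lTensor A (G.galL (c ⊗ₜ a)) = 0 := by
    intro c
    have h := G.coassoc c a H.p
    rw [hfix] at h
    have e : ∀ t : A ⊗[ℂ] A, K.lTensor A t =
        G.galR.toLinearMap.lTensor A (TensorProduct.assoc ℂ A A A (t ⊗ₜ H.p)) -
          TensorProduct.assoc ℂ A A A (t ⊗ₜ H.p) := by
      intro t
      induction t using TensorProduct.induction_on with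
      | zero => simp
      | add x y hx hy => simp only [map_add, TensorProduct.add_tmul, hx, hy]; abel
      | tmul x y => simp [hK, TensorProduct.tmul_sub]
    rw [e, ← h]
    simp
  have hw : K.lTensor A (G.galRL (a ⊗ₜ b)) = 0 := by
    apply G.eq_zero_of_mulLeft_rTensor
    intro c
    have e₁ : ∀ t : A ⊗[ℂ] A, (LinearMap.mulLeft ℂ c).rTensor (A ⊗[ℂ] A) (K.lTensor A t) =
        K.lTensor A ((tmulOne c).lact t) := by
      intro t
      induction t using TensorProduct.induction_on with
      | zero => simp
      | add x y hx hy => simp only [map_add, hx, hy]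
      | tmul x y => simp
    have e₂ : ∀ t : A ⊗[ℂ] A, K.lTensor A ((tmulOne b).ract t) =
        (LinearMap.mulRight ℂ b).rTensor (A ⊗[ℂ] A) (K.lTensor A t) := by
      intro t
      induction t using TensorProduct.induction_on with
      | zero => simp
      | add x y hx hy => simp only [map_add, hx, hy]
      | tmul x y => simp
    rw [e₁, G.tmulOne_lact_galRL, e₂, hu, map_zero]
  apply hmem
  have e : ∀ t : A ⊗[ℂ] A, K (sliceLeft G.φ t) =
      TensorProduct.lid ℂ (A ⊗[ℂ] A) (G.φ.rTensor (A ⊗[ℂ] A) (K.lTensor A t)) := by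
    intro t
    induction t using TensorProduct.induction_on with
    | zero => simp
    | add x y hx hy => simp only [map_add, hx, hy]
    | tmul x y => simp
  change K (sliceLeft G.φ (G.galRL (a ⊗ₜ b))) = 0
  rw [e, hw, map_zero, map_zero]

/-- The action of `φ(· b) ∈ 𝒟(𝔾)` on `c_c(𝔾/ℍ)`. -/
noncomputable def actCC (b : A) : Module.End ℂ H.cc := (G.act b).restrict (H.act_mem_cc b)

/-- `End_𝔾(c_c(𝔾/ℍ))`: the algebra, under composition, of the linear endomorphisms of `c_c(𝔾/ℍ)`
that commute with the action of every element of `𝒟(𝔾)`. -/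
noncomputable def endG : Subalgebra ℂ (Module.End ℂ H.cc) :=
  Subalgebra.centralizer ℂ (Set.range H.actCC)

end CompactOpenSubgroup

end AlgebraicQuantumGroup

end AlgQG

namespace AlgQG

section Coassociativity

variable {A : Type*} [NonUnitalRing A] [Module ℂ A] [IsScalarTower ℂ A A] [SMulCommClass ℂ A A]
  [StarRing A] [StarModule ℂ A]

/-! ### Cancelling multiplication on one leg of a tensor product -/

namespace MultiplierHopfStarAlgebra

/-! The module `c_c(𝔾/ℍ)` is cyclic over `𝒟(𝔾)`, generated by `p`. Hence an equivariant endomorphism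
`F` is determined by `F(p)`, and the theorem amounts to identifying the possible values `F(p)` with
the Hecke algebra.

Cyclicity rests on the identity `Δ(p)(1 ⊗ h) = Δ(p)(b ⊗ 1)` for `h` in `c_c(𝔾/ℍ)` (`galR_p_eq`). It
follows from `px = ε(x)p` on `c_c(𝔾/ℍ)`, so a counit is needed, but no antipode. Applying `ψ ⊗ id`
gives `h = (ψ(· b) ⊗ id)Δ(p)`, and `ψ(· b)` lies in `𝒟(𝔾)` by `exists_fourier_eq`.

Right convolution is equivariant (`act_conv`) and `p * f = f` for left invariant `f`, so every Hecke
element `f` is the value at `p` of `h ↦ h * f`. Conversely `p` is fixed by `ψ(· p)`, so `F(p)` is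
fixed by it as well, and elements of the form `(ψ(· p) ⊗ id)Δ(k)` are left invariant. Closure under
convolution, anti-multiplicativity and associativity are then read off from composition of
endomorphisms evaluated at `p`. -/

theorem eq_zero_of_mulRight_rTensor (G : MultiplierHopfStarAlgebra A) {V : Type*}
    [AddCommGroup V] [Module ℂ V] (w : A ⊗[ℂ] V)
    (h : ∀ c : A, (LinearMap.mulRight ℂ c).rTensor V w = 0) : w = 0 := by
  classical
  let e := TensorProduct.equivFinsuppOfBasisRight (M := A) (Module.Basis.ofVectorSpace ℂ V)
  have key : ∀ (c : A) (w : A ⊗[ℂ] V) (i),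
      e ((LinearMap.mulRight ℂ c).rTensor V w) i = e w i * c := by
    intro c w i
    induction w using TensorProduct.induction_on with
    | zero => simp
    | add x y hx hy => simp only [map_add, Finsupp.add_apply, add_mul, hx, hy]
    | tmul x y => simp [e, smul_mul_assoc]
  apply e.injective
  rw [map_zero]
  ext i
  refine G.eq_zero_of_mul_right _ fun c => ?_
  rw [← key, h c, map_zero, Finsupp.zero_apply]

theorem eq_of_mulRight_rTensor (G : MultiplierHopfStarAlgebra A) {V : Type*}
    [AddCommGroup V] [Module ℂ V] {v w : A ⊗[ℂ] V}
    (h : ∀ c : A, (LinearMap.mulRight ℂ c).rTensor V v = (LinearMap.mulRight ℂ c).rTensor V w) :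
    v = w :=
  sub_eq_zero.1 (G.eq_zero_of_mulRight_rTensor _ fun c => by rw [map_sub, h, sub_self])

theorem eq_of_mulRight_lTensor (G : MultiplierHopfStarAlgebra A) {V : Type*}
    [AddCommGroup V] [Module ℂ V] {v w : V ⊗[ℂ] A}
    (h : ∀ c : A, (LinearMap.mulRight ℂ c).lTensor V v = (LinearMap.mulRight ℂ c).lTensor V w) :
    v = w := by
  apply (TensorProduct.comm ℂ V A).injective
  apply G.eq_of_mulRight_rTensor
  intro c
  have e : ∀ t : V ⊗[ℂ] A, (LinearMap.mulRight ℂ c).rTensor V (TensorProduct.comm ℂ V A t) =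
      TensorProduct.comm ℂ V A ((LinearMap.mulRight ℂ c).lTensor V t) := by
    intro t
    induction t using TensorProduct.induction_on with
    | zero => simp
    | add x y hx hy => simp only [map_add, hx, hy]
    | tmul x y => simp
  rw [e, e, h]

theorem eq_of_mulLeft_rTensor (G : MultiplierHopfStarAlgebra A) {V : Type*}
    [AddCommGroup V] [Module ℂ V] {v w : A ⊗[ℂ] V}
    (h : ∀ c : A, (LinearMap.mulLeft ℂ c).rTensor V v = (LinearMap.mulLeft ℂ c).rTensor V w) :
    v = w :=
  sub_eq_zero.1 (G.eq_zero_of_mulLeft_rTensor _ fun c => by rw [map_sub, h, sub_self])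

variable (G : MultiplierHopfStarAlgebra A)

/-! ### The counit -/

/-- `(a ⊗ 1)(Δ(b)(1 ⊗ c)) = ((a ⊗ 1)Δ(b))(1 ⊗ c)`. -/
theorem tmulOne_lact_galR (a b c : A) :
    (tmulOne a).lact (G.galR (b ⊗ₜ c)) = (oneTmul c).ract (G.galL (a ⊗ₜ b)) := by
  apply G.of_injective
  rw [← Multiplier.mul_of, ← Multiplier.of_mul, G.of_galR, G.of_galL, mul_assoc]

/-- Van Daele's construction: the counit is what remains of multiplication after undoing `a ⊗ b ↦
Δ(a)(1 ⊗ b)`. Coassociativity forces the result to be a scalar multiple of the second factor. -/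
theorem exists_counit [Nontrivial A] :
    ∃ ε : A →ₗ[ℂ] ℂ, ∀ x y : A, LinearMap.mul' ℂ A (G.galR.symm (x ⊗ₜ y)) = ε x • y := by
  -- `E y x` plays the role of `ε(x)y`; `h₁` below is then the counit law `(id ⊗ ε)((a ⊗ 1)Δ(x)) =
  -- ax`, tensored with `y`.
  let E : A → A →ₗ[ℂ] A := fun y =>
    LinearMap.mul' ℂ A ∘ₗ G.galR.symm.toLinearMap ∘ₗ (TensorProduct.mk ℂ A A).flip y
  have h₁ : ∀ a x y : A, (E y).lTensor A (G.galL (a ⊗ₜ x)) = (a * x) ⊗ₜ y := by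
    intro a x y
    let M : A ⊗[ℂ] A →ₗ[ℂ] A := LinearMap.mul' ℂ A ∘ₗ G.galR.symm.toLinearMap
    have hE : ∀ t : A ⊗[ℂ] A, (E y).lTensor A t =
        M.lTensor A (TensorProduct.assoc ℂ A A A (t ⊗ₜ y)) := by
      intro t
      induction t using TensorProduct.induction_on with
      | zero => simp
      | add u v hu hv => simp only [map_add, TensorProduct.add_tmul, hu, hv]
      | tmul u v => simp [E, M]
    have hM : ∀ b c : A, M.lTensor A (G.galR.toLinearMap.lTensor A
        (TensorProduct.assoc ℂ A A A (G.galL (a ⊗ₜ b) ⊗ₜ c))) =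
        (tmulOne a).lact (G.galR (b ⊗ₜ c)) := by
      intro b c
      rw [tmulOne_lact_galR]
      generalize G.galL (a ⊗ₜ[ℂ] b) = t
      induction t using TensorProduct.induction_on with
      | zero => simp
      | add u v hu hv => simp only [map_add, TensorProduct.add_tmul, hu, hv]
      | tmul u v => simp [M]
    have h₂ : ∀ s : A ⊗[ℂ] A, M.lTensor A (TensorProduct.assoc ℂ A A A
        (G.galL.toLinearMap.rTensor A ((TensorProduct.assoc ℂ A A A).symm (a ⊗ₜ G.galR s)))) =
        (tmulOne a).lact (G.galR s) := by
      intro s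
      induction s using TensorProduct.induction_on with
      | zero => simp
      | add u v hu hv => simp only [map_add, TensorProduct.tmul_add, hu, hv]
      | tmul b c => rw [G.coassoc, hM]
    have h₃ := h₂ (G.galR.symm (x ⊗ₜ y))
    rw [LinearEquiv.apply_symm_apply] at h₃
    simpa [hE] using h₃
  have h₂ : ∀ (y : A) (t : A ⊗[ℂ] A), (E y).lTensor A t =
      LinearMap.mul' ℂ A (G.galL.symm t) ⊗ₜ y := by
    intro y t
    obtain ⟨s, rfl⟩ := G.galL.surjective t
    rw [LinearEquiv.symm_apply_apply]
    induction s using TensorProduct.induction_on with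
    | zero => simp
    | add u v hu hv => simp only [map_add, TensorProduct.add_tmul, hu, hv]
    | tmul a x => rw [h₁, LinearMap.mul'_apply]
  -- By `h₂`, `a ⊗ E y x` is some element depending only on `a` and `x`, tensored with `y`. Slicing
  -- the first leg with a functional `ω` such that `ω(a) = 1` exhibits `E y x` as a scalar times
  -- `y`.
  obtain ⟨a, ha⟩ := exists_ne (0 : A)
  obtain ⟨ω, hω⟩ := Module.Projective.exists_dual_eq_one ℂ ha
  refine ⟨ω ∘ₗ LinearMap.mul' ℂ A ∘ₗ G.galL.symm.toLinearMap ∘ₗ TensorProduct.mk ℂ A A a,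
    fun x y => ?_⟩
  have h := congrArg (fun t => TensorProduct.lid ℂ A (ω.rTensor A t)) (h₂ y (a ⊗ₜ x))
  simpa [hω, E] using h

/-! ### Covered forms of coassociativity -/

/-- `Δ(ha)(1 ⊗ b) = Δ(h)(Δ(a)(1 ⊗ b))`. -/
theorem galR_mul (h a b : A) :
    G.galR ((h * a) ⊗ₜ b) = (G.comul h).lact (G.galR (a ⊗ₜ b)) := by
  apply G.of_injective
  rw [← Multiplier.mul_of, G.of_galR, G.of_galR, map_mul, mul_assoc]

/-- `(Δ(m)(q ⊗ 1))(1 ⊗ r) = Δ(m)(q ⊗ r)`. -/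
theorem oneTmul_ract_galRL_eq (m q r : A) :
    (oneTmul r).ract (G.galRL (m ⊗ₜ q)) = (G.comul m).lact (q ⊗ₜ r) := by
  have h : tmulOne q * oneTmul r = Multiplier.of (q ⊗ₜ[ℂ] r) := by
    apply Multiplier.ext_acts <;> intro x <;>
    · induction x using TensorProduct.induction_on with
      | zero => simp only [map_zero]
      | add x₁ x₂ h₁ h₂ => rw [map_add, map_add, h₁, h₂]
      | tmul u v => simp
  apply G.of_injective
  rw [← Multiplier.of_mul, ← Multiplier.mul_of, G.of_galRL, mul_assoc, h]

/-- `z ↦ Δ(z)(1 ⊗ c)`. -/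
noncomputable def coR (c : A) : A →ₗ[ℂ] A ⊗[ℂ] A :=
  G.galR.toLinearMap ∘ₗ (TensorProduct.mk ℂ A A).flip c

/-- `z ↦ Δ(z)(c ⊗ 1)`. -/
noncomputable def coRL (c : A) : A →ₗ[ℂ] A ⊗[ℂ] A :=
  G.galRL.toLinearMap ∘ₗ (TensorProduct.mk ℂ A A).flip c

@[simp] theorem coR_apply (c z : A) : G.coR c z = G.galR (z ⊗ₜ c) := rfl

@[simp] theorem coRL_apply (c z : A) : G.coRL c z = G.galRL (z ⊗ₜ c) := rfl

/-- `x₍₁₎y ⊗ x₍₂₎ ⊗ x₍₃₎c`, computed in two ways. -/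
theorem lTensor_coR_galRL (x y c : A) :
    (G.coR c).lTensor A (G.galRL (x ⊗ₜ y)) =
      TensorProduct.assoc ℂ A A A ((G.coRL y).rTensor A (G.galR (x ⊗ₜ c))) := by
  -- A factor `d` on the left of the first leg turns `Δ(x)(y ⊗ 1)` into `((d ⊗ 1)Δ(x))(y ⊗ 1)`. Then
  -- `y` can be pulled out and the coassociativity axiom applies.
  apply G.eq_of_mulLeft_rTensor
  intro d
  have e₁ : ∀ t : A ⊗[ℂ] A, (LinearMap.mulLeft ℂ d).rTensor (A ⊗[ℂ] A) ((G.coR c).lTensor A t) =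
      (G.coR c).lTensor A ((tmulOne d).lact t) := by
    intro t
    induction t using TensorProduct.induction_on with
    | zero => simp
    | add x y hx hy => simp only [map_add, hx, hy]
    | tmul x y => simp
  have e₂ : ∀ t : A ⊗[ℂ] A, (G.coR c).lTensor A ((tmulOne y).ract t) =
      (LinearMap.mulRight ℂ y).rTensor (A ⊗[ℂ] A)
        (G.galR.toLinearMap.lTensor A (TensorProduct.assoc ℂ A A A (t ⊗ₜ c))) := by
    intro t
    induction t using TensorProduct.induction_on with
    | zero => simp
    | add x y hx hy => simp only [map_add, TensorProduct.add_tmul, hx, hy]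
    | tmul x y => simp
  have e₃ : ∀ (t : A ⊗[ℂ] A) (n : A), (LinearMap.mulLeft ℂ d).rTensor (A ⊗[ℂ] A)
      (TensorProduct.assoc ℂ A A A (t ⊗ₜ n)) =
        TensorProduct.assoc ℂ A A A ((tmulOne d).lact t ⊗ₜ n) := by
    intro t n
    induction t using TensorProduct.induction_on with
    | zero => simp
    | add x y hx hy => simp only [map_add, TensorProduct.add_tmul, hx, hy]
    | tmul x y => simp
  have e₄ : ∀ (t : A ⊗[ℂ] A) (n : A), TensorProduct.assoc ℂ A A A ((tmulOne y).ract t ⊗ₜ n) =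
      (LinearMap.mulRight ℂ y).rTensor (A ⊗[ℂ] A) (TensorProduct.assoc ℂ A A A (t ⊗ₜ n)) := by
    intro t n
    induction t using TensorProduct.induction_on with
    | zero => simp
    | add x y hx hy => simp only [map_add, TensorProduct.add_tmul, hx, hy]
    | tmul x y => simp
  have e₅ : ∀ s : A ⊗[ℂ] A, (LinearMap.mulLeft ℂ d).rTensor (A ⊗[ℂ] A)
      (TensorProduct.assoc ℂ A A A ((G.coRL y).rTensor A s)) =
        (LinearMap.mulRight ℂ y).rTensor (A ⊗[ℂ] A) (TensorProduct.assoc ℂ A A A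
          (G.galL.toLinearMap.rTensor A ((TensorProduct.assoc ℂ A A A).symm (d ⊗ₜ s)))) := by
    intro s
    induction s using TensorProduct.induction_on with
    | zero => simp
    | add x y hx hy => simp only [map_add, TensorProduct.tmul_add, hx, hy]
    | tmul m n =>
      simp only [LinearMap.rTensor_tmul, coRL_apply, e₃, G.tmulOne_lact_galRL, e₄,
        TensorProduct.assoc_symm_tmul, LinearEquiv.coe_coe]
  rw [e₁, G.tmulOne_lact_galRL, e₂, e₅, G.coassoc]

/-- `(m ⊗ n) ⊗ y ↦ m₍₁₎y ⊗ m₍₂₎ ⊗ n`. -/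
noncomputable def galRLFst : (A ⊗[ℂ] A) ⊗[ℂ] A ≃ₗ[ℂ] A ⊗[ℂ] (A ⊗[ℂ] A) :=
  (TensorProduct.rightComm ℂ A A A ≪≫ₗ G.galRL.rTensor A) ≪≫ₗ TensorProduct.assoc ℂ A A A

theorem galRLFst_tmul (t : A ⊗[ℂ] A) (y : A) :
    G.galRLFst (t ⊗ₜ y) = TensorProduct.assoc ℂ A A A ((G.coRL y).rTensor A t) := by
  induction t using TensorProduct.induction_on with
  | zero => simp
  | add u v hu hv => simp only [map_add, TensorProduct.add_tmul, hu, hv]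
  | tmul u v => simp [galRLFst]

theorem lTensor_coR_galRL' (c : A) (t : A ⊗[ℂ] A) :
    (G.coR c).lTensor A (G.galRL t) = G.galRLFst ((G.coR c).rTensor A t) := by
  induction t using TensorProduct.induction_on with
  | zero => simp
  | add u v hu hv => simp only [map_add, hu, hv]
  | tmul x y => rw [lTensor_coR_galRL, LinearMap.rTensor_tmul, galRLFst_tmul, coR_apply]

theorem lTensor_mk_galRL (c : A) (t : A ⊗[ℂ] A) :
    ((TensorProduct.mk ℂ A A).flip c).lTensor A (G.galRL t) =
      G.galRLFst (((TensorProduct.mk ℂ A A).flip c).rTensor A t) := by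
  have e : ∀ s : A ⊗[ℂ] A, ((TensorProduct.mk ℂ A A).flip c).lTensor A s =
      TensorProduct.assoc ℂ A A A (s ⊗ₜ c) := by
    intro s
    induction s using TensorProduct.induction_on with
    | zero => simp
    | add u v hu hv => simp only [map_add, TensorProduct.add_tmul, hu, hv]
    | tmul x y => simp
  induction t using TensorProduct.induction_on with
  | zero => simp
  | add u v hu hv => simp only [map_add, hu, hv]
  | tmul x y => simp [galRLFst_tmul, e]

/-- `q ⊗ r ↦ x₍₁₎q ⊗ x₍₂₎r ⊗ x₍₃₎`. -/
noncomputable def comulTwo (x : A) : A ⊗[ℂ] A →ₗ[ℂ] A ⊗[ℂ] (A ⊗[ℂ] A) :=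
  G.galRL.toLinearMap.lTensor A ∘ₗ (TensorProduct.assoc ℂ A A A).toLinearMap ∘ₗ
    (G.galRL.toLinearMap ∘ₗ TensorProduct.mk ℂ A A x).rTensor A

/-- `m ↦ Δ(m)t`. -/
noncomputable def comulMul (t : A ⊗[ℂ] A) : A →ₗ[ℂ] A ⊗[ℂ] A where
  toFun m := (G.comul m).lact t
  map_add' m n := by rw [map_add]; rfl
  map_smul' r m := by rw [map_smul]; rfl

theorem comulMul_apply (t : A ⊗[ℂ] A) (m : A) : G.comulMul t m = (G.comul m).lact t := rfl

theorem comulMul_add (s t : A ⊗[ℂ] A) : G.comulMul (s + t) = G.comulMul s + G.comulMul t :=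
  LinearMap.ext fun m => map_add (G.comul m).lact s t

theorem comulMul_zero : G.comulMul 0 = 0 :=
  LinearMap.ext fun m => map_zero (G.comul m).lact

/-- Coassociativity lets the iterated coproduct in `comulTwo`, built by applying `Δ` to the second
leg, be recomputed by applying `Δ` to the first leg. The factor `c` is needed only to make the
second bracketing land in the tensor cube. -/
theorem lTensor_ract_comulTwo (x c : A) (t : A ⊗[ℂ] A) :
    ((oneTmul c).ract).lTensor A (G.comulTwo x t) =
      TensorProduct.assoc ℂ A A A ((G.comulMul t).rTensor A (G.galR (x ⊗ₜ c))) := by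
  induction t using TensorProduct.induction_on with
  | zero => simp [comulMul_zero]
  | add u v hu hv => simp only [map_add, comulMul_add, LinearMap.rTensor_add,
      LinearMap.add_apply, hu, hv]
  | tmul q r =>
    have e₁ : ∀ s : A ⊗[ℂ] A, ((oneTmul c).ract).lTensor A (G.galRL.toLinearMap.lTensor A
        (TensorProduct.assoc ℂ A A A (s ⊗ₜ r))) =
        ((tmulOne r).ract).lTensor A ((G.coR c).lTensor A s) := by
      intro s
      induction s using TensorProduct.induction_on with
      | zero => simp
      | add u v hu hv => simp only [map_add, TensorProduct.add_tmul, hu, hv]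
      | tmul u v => simp [G.oneTmul_ract_galRL]
    have e₂ : ∀ (s : A ⊗[ℂ] A) (n : A), ((tmulOne r).ract).lTensor A
        (TensorProduct.assoc ℂ A A A (s ⊗ₜ n)) =
        TensorProduct.assoc ℂ A A A ((oneTmul r).ract s ⊗ₜ n) := by
      intro s n
      induction s using TensorProduct.induction_on with
      | zero => simp
      | add u v hu hv => simp only [map_add, TensorProduct.add_tmul, hu, hv]
      | tmul u v => simp
    have e₃ : ∀ s : A ⊗[ℂ] A, ((tmulOne r).ract).lTensor A
        (TensorProduct.assoc ℂ A A A ((G.coRL q).rTensor A s)) =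
        TensorProduct.assoc ℂ A A A ((G.comulMul (q ⊗ₜ r)).rTensor A s) := by
      intro s
      induction s using TensorProduct.induction_on with
      | zero => simp
      | add u v hu hv => simp only [map_add, hu, hv]
      | tmul m n =>
        simp only [LinearMap.rTensor_tmul, coRL_apply, e₂, oneTmul_ract_galRL_eq, comulMul_apply]
    have e₀ : G.comulTwo x (q ⊗ₜ r) = G.galRL.toLinearMap.lTensor A
        (TensorProduct.assoc ℂ A A A (G.galRL (x ⊗ₜ q) ⊗ₜ r)) := rfl
    rw [e₀, e₁, lTensor_coR_galRL, e₃]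

/-- If `g(my) = Δ(m)g(y)`, for instance `g(z) = Δ(z)(b ⊗ 1)` or `g(z) = Δ(z)(1 ⊗ b)`, then
`(g ⊗ id)(Δ(x)(y ⊗ 1)) = (Δ ⊗ id)(Δ(x))(g(y) ⊗ 1)`. -/
theorem assoc_rTensor_galRL (g : A →ₗ[ℂ] A ⊗[ℂ] A)
    (hg : ∀ m y, g (m * y) = (G.comul m).lact (g y)) (x y : A) :
    TensorProduct.assoc ℂ A A A (g.rTensor A (G.galRL (x ⊗ₜ y))) = G.comulTwo x (g y) := by
  apply (TensorProduct.assoc ℂ A A A).symm.injective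
  apply G.eq_of_mulRight_lTensor
  intro c
  apply (TensorProduct.assoc ℂ A A A).injective
  have e₀ : ∀ w : A ⊗[ℂ] (A ⊗[ℂ] A), TensorProduct.assoc ℂ A A A
      ((LinearMap.mulRight ℂ c).lTensor (A ⊗[ℂ] A) ((TensorProduct.assoc ℂ A A A).symm w)) =
      ((oneTmul c).ract).lTensor A w := by
    intro w
    induction w using TensorProduct.induction_on with
    | zero => simp
    | add u v hu hv => simp only [map_add, hu, hv]
    | tmul u w =>
      induction w using TensorProduct.induction_on with
      | zero => simp
      | add u v hu hv => simp only [map_add, TensorProduct.tmul_add, hu, hv]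
      | tmul v w => simp
  have e₁ : ∀ (t : A ⊗[ℂ] A) (n : A), ((oneTmul c).ract).lTensor A
      (TensorProduct.assoc ℂ A A A (t ⊗ₜ n)) = TensorProduct.assoc ℂ A A A (t ⊗ₜ (n * c)) := by
    intro t n
    induction t using TensorProduct.induction_on with
    | zero => simp
    | add u v hu hv => simp only [map_add, TensorProduct.add_tmul, hu, hv]
    | tmul u v => simp
  have e₂ : ∀ t : A ⊗[ℂ] A, ((oneTmul c).ract).lTensor A
      (TensorProduct.assoc ℂ A A A (g.rTensor A t)) =
      TensorProduct.assoc ℂ A A A (g.rTensor A ((oneTmul c).ract t)) := by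
    intro t
    induction t using TensorProduct.induction_on with
    | zero => simp
    | add u v hu hv => simp only [map_add, hu, hv]
    | tmul u v => simp [e₁]
  have e₃ : ∀ t : A ⊗[ℂ] A, g.rTensor A ((tmulOne y).ract t) = (G.comulMul (g y)).rTensor A t := by
    intro t
    induction t using TensorProduct.induction_on with
    | zero => simp
    | add u v hu hv => simp only [map_add, hu, hv]
    | tmul u v => simp [hg, comulMul_apply]
  rw [e₀, e₀, lTensor_ract_comulTwo, e₂, G.oneTmul_ract_galRL, e₃]

end MultiplierHopfStarAlgebra

end Coassociativity

end AlgQG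

namespace AlgQG

/-! ### Compatibility of slices with multiplication and the coproduct -/

section Slices

variable {A : Type*} [NonUnitalRing A] [Module ℂ A]

theorem sliceLeft_assoc_tmul (ω : A →ₗ[ℂ] ℂ) (t : A ⊗[ℂ] A) (n : A) :
    TensorProduct.lid ℂ (A ⊗[ℂ] A) (ω.rTensor (A ⊗[ℂ] A) (TensorProduct.assoc ℂ A A A (t ⊗ₜ n))) =
      sliceLeft ω t ⊗ₜ n := by
  induction t using TensorProduct.induction_on with
  | zero => simp
  | add u v hu hv => simp only [map_add, TensorProduct.add_tmul, hu, hv]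
  | tmul u v => simp [TensorProduct.smul_tmul']

variable [IsScalarTower ℂ A A] [SMulCommClass ℂ A A]

theorem sliceRight_ract_tmulOne (ω : A →ₗ[ℂ] ℂ) (b : A) (t : A ⊗[ℂ] A) :
    sliceRight ω ((tmulOne b).ract t) = sliceRight ω t * b := by
  induction t using TensorProduct.induction_on with
  | zero => simp
  | add x y hx hy => simp only [map_add, add_mul, hx, hy]
  | tmul x y => simp [smul_mul_assoc]

end Slices

section HeckeAlgebra

variable {A : Type*} [NonUnitalRing A] [Module ℂ A] [IsScalarTower ℂ A A] [SMulCommClass ℂ A A]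
  [StarRing A] [StarModule ℂ A]

namespace MultiplierHopfStarAlgebra

variable (G : MultiplierHopfStarAlgebra A)

theorem eq_of_ract_tmulOne (G : MultiplierHopfStarAlgebra A) {s t : A ⊗[ℂ] A}
    (h : ∀ c, (tmulOne c).ract s = (tmulOne c).ract t) : s = t :=
  G.eq_of_mulRight_rTensor h

theorem ract_tmulOne_galRL (a b c : A) :
    (tmulOne c).ract (G.galRL (a ⊗ₜ b)) = G.galRL (a ⊗ₜ (b * c)) := by
  have h : tmulOne b * tmulOne c = tmulOne (A := A) (b * c) := by
    apply Multiplier.ext_acts <;> intro x <;>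
    · induction x using TensorProduct.induction_on with
      | zero => simp only [map_zero]
      | add x₁ x₂ h₁ h₂ => rw [map_add, map_add, h₁, h₂]
      | tmul u v => simp [mul_assoc]
  apply G.of_injective
  rw [← Multiplier.of_mul, G.of_galRL, G.of_galRL, mul_assoc, h]

theorem ract_tmulOne_galR (a b c : A) :
    (tmulOne c).ract (G.galR (a ⊗ₜ b)) = (G.comul a).lact (c ⊗ₜ b) := by
  rw [← G.oneTmul_ract_galRL, G.oneTmul_ract_galRL_eq]

theorem comul_lact_galRL (h : A) (t : A ⊗[ℂ] A) :
    (G.comul h).lact (G.galRL t) = G.galRL ((LinearMap.mulLeft ℂ h).rTensor A t) := by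
  induction t using TensorProduct.induction_on with
  | zero => simp
  | add x y hx hy => simp only [map_add, hx, hy]
  | tmul x y => simp [G.galRL_mul]

theorem sliceLeft_galRL_mul (ω : A →ₗ[ℂ] ℂ) (a b c : A) :
    sliceLeft ω (G.galRL (a ⊗ₜ b)) * c =
      sliceLeft (ω ∘ₗ LinearMap.mulRight ℂ b) (G.galR (a ⊗ₜ c)) := by
  have h₁ : ∀ t : A ⊗[ℂ] A, sliceLeft ω t * c = sliceLeft ω ((oneTmul c).ract t) := by
    intro t
    induction t using TensorProduct.induction_on with
    | zero => simp
    | add x y hx hy => simp only [map_add, add_mul, hx, hy]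
    | tmul x y => simp [smul_mul_assoc]
  have h₂ : ∀ t : A ⊗[ℂ] A, sliceLeft ω ((tmulOne b).ract t) =
      sliceLeft (ω ∘ₗ LinearMap.mulRight ℂ b) t := by
    intro t
    induction t using TensorProduct.induction_on with
    | zero => simp
    | add x y hx hy => simp only [map_add, hx, hy]
    | tmul x y => simp
  rw [h₁, G.oneTmul_ract_galRL, h₂]

/-- `(ω ⊗ id)(Δ(x₍₁₎)(q ⊗ r) ⊗ x₍₂₎) = Δ(ω(x₍₁₎q)x₍₂₎)(r ⊗ 1)`. -/
theorem sliceLeft_comulTwo (ω : A →ₗ[ℂ] ℂ) (x q r : A) :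
    TensorProduct.lid ℂ (A ⊗[ℂ] A) (ω.rTensor (A ⊗[ℂ] A) (G.comulTwo x (q ⊗ₜ r))) =
      G.galRL (sliceLeft ω (G.galRL (x ⊗ₜ q)) ⊗ₜ r) := by
  have e : ∀ t : A ⊗[ℂ] A, TensorProduct.lid ℂ (A ⊗[ℂ] A) (ω.rTensor (A ⊗[ℂ] A)
      (G.galRL.toLinearMap.lTensor A (TensorProduct.assoc ℂ A A A (t ⊗ₜ r)))) =
      G.galRL (sliceLeft ω t ⊗ₜ r) := by
    intro t
    induction t using TensorProduct.induction_on with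
    | zero => simp
    | add u v hu hv => simp only [map_add, TensorProduct.add_tmul, hu, hv]
    | tmul u v => simp [← TensorProduct.smul_tmul']
  exact e _

end MultiplierHopfStarAlgebra

/-! ### Haar functionals, the dual action and convolution -/

namespace AlgebraicQuantumGroup

variable (G : AlgebraicQuantumGroup A)

theorem act_apply (b a : A) : G.act b a = sliceLeft G.φ (G.galRL (a ⊗ₜ b)) := rfl

/-- Every functional `ψ(· r)` is of the form `φ(· b)`. -/
theorem exists_fourier_eq (r : A) : ∃ b : A, G.ψ ∘ₗ LinearMap.mulRight ℂ r = G.fourier b := by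
  obtain ⟨s, hs⟩ : ∃ s, G.φ s = 1 := by
    obtain ⟨s, hs⟩ : ∃ s, G.φ s ≠ 0 := by
      by_contra! h
      exact G.φ_ne_zero (LinearMap.ext h)
    exact ⟨(G.φ s)⁻¹ • s, by simp [hs]⟩
  obtain ⟨t, ht⟩ := G.galRL.surjective (G.galR (r ⊗ₜ[ℂ] s))
  -- Write `Δ(r)(1 ⊗ s) = ∑ Δ(u)(v ⊗ 1)`. Evaluating `(ψ ⊗ φ)(Δ(xr)(1 ⊗ s))` by right invariance
  -- gives `ψ(xr)`, and by left invariance `φ(x ∑ ψ(v)u)`; the witness is `∑ ψ(v)u`.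
  refine ⟨sliceRight G.ψ t, LinearMap.ext fun x => ?_⟩
  have h₁ : G.galR ((x * r) ⊗ₜ[ℂ] s) = G.galRL ((LinearMap.mulLeft ℂ x).rTensor A t) := by
    rw [G.galR_mul, ← ht, G.comul_lact_galRL]
  have h₂ : ∀ t : A ⊗[ℂ] A, G.φ (sliceLeft G.ψ t) = G.ψ (sliceRight G.φ t) := by
    intro t
    induction t using TensorProduct.induction_on with
    | zero => simp
    | add x y hx hy => simp only [map_add, hx, hy]
    | tmul x y => simp [mul_comm]
  have h₃ : ∀ t : A ⊗[ℂ] A, G.ψ (sliceRight G.φ (G.galRL ((LinearMap.mulLeft ℂ x).rTensor A t))) =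
      G.φ (x * sliceRight G.ψ t) := by
    intro t
    induction t using TensorProduct.induction_on with
    | zero => simp
    | add x y hx hy => simp only [map_add, mul_add, hx, hy]
    | tmul u v => simp [φ_invariant', mul_smul_comm, mul_comm]
  have h₄ := G.ψ_invariant (x * r) s
  rw [h₁] at h₄
  have h₅ := congrArg G.φ h₄
  rw [h₂, h₃, map_smul, hs, smul_eq_mul, mul_one] at h₅
  exact h₅.symm

/-- Makes equivariance usable for functionals built from `ψ`, the ones to which right invariance
applies. -/
theorem exists_act_eq (r : A) : ∃ b : A, ∀ a, sliceLeft G.ψ (G.galRL (a ⊗ₜ r)) = G.act b a := by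
  obtain ⟨b, hb⟩ := G.exists_fourier_eq r
  refine ⟨b, fun a => ?_⟩
  rw [← sub_eq_zero]
  refine G.eq_zero_of_mul_right _ fun c => ?_
  rw [sub_mul, act_mul, G.sliceLeft_galRL_mul, hb, sub_self]

/-- Convolution from the right commutes with the action of `𝒟(𝔾)`. -/
theorem act_conv (b h f : A) : G.act b (G.conv h f) = G.conv (G.act b h) f := by
  have e : ∀ (x : A) (s : A ⊗[ℂ] A), sliceRight G.φ (G.galRL.symm
      (TensorProduct.lid ℂ (A ⊗[ℂ] A) (G.φ.rTensor (A ⊗[ℂ] A) (G.comulTwo x s)))) =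
      G.act (sliceRight G.φ s) x := by
    intro x s
    induction s using TensorProduct.induction_on with
    | zero => simp [act_apply]
    | add u v hu hv =>
      simp only [map_add, hu, hv, act_apply, TensorProduct.tmul_add]
    | tmul q r =>
      rw [G.sliceLeft_comulTwo, LinearEquiv.symm_apply_apply]
      simp [act_apply]
  -- If `h ⊗ f = ∑ Δ(x)(y ⊗ 1)`, then `h * f = ∑ φ(y)x`. Coassociativity and `e` turn `(h · ω) * f`,
  -- with `ω = φ(· b)`, into a sum of actions on `x` by `(id ⊗ φ)(Δ(y)(b ⊗ 1))`, which is `φ(y)b` by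
  -- left invariance.
  have e₂ : ∀ t : A ⊗[ℂ] A, sliceRight G.φ (G.galRL.symm
      (TensorProduct.lid ℂ (A ⊗[ℂ] A) (G.φ.rTensor (A ⊗[ℂ] A)
        (TensorProduct.assoc ℂ A A A ((G.coRL b).rTensor A (G.galRL t)))))) =
      G.act b (sliceRight G.φ t) := by
    intro t
    induction t using TensorProduct.induction_on with
    | zero => simp
    | add u v hu hv => simp only [map_add, hu, hv]
    | tmul x y =>
      rw [G.assoc_rTensor_galRL (G.coRL b) (fun m y => G.galRL_mul m y b), e,
        MultiplierHopfStarAlgebra.coRL_apply, φ_invariant']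
      simp [act_apply]
  have h₁ := e₂ (G.galRL.symm (h ⊗ₜ f))
  rw [LinearEquiv.apply_symm_apply, LinearMap.rTensor_tmul, sliceLeft_assoc_tmul] at h₁
  exact h₁.symm

/-- The convolution product as a bilinear map. -/
noncomputable def convLin : A →ₗ[ℂ] A →ₗ[ℂ] A :=
  (TensorProduct.mk ℂ A A).compr₂ (sliceRight G.φ ∘ₗ G.galRL.symm.toLinearMap)

variable {G}

/-! ### Invariant elements and cyclicity of the module -/

namespace CompactOpenSubgroup

variable (H : G.CompactOpenSubgroup)

theorem mem_cc_iff {f : A} : f ∈ H.cc ↔ G.galR (f ⊗ₜ H.p) = f ⊗ₜ H.p := by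
  refine ⟨fun h => G.of_injective ((G.of_galR f H.p).trans h), fun h => ?_⟩
  change G.comul f * oneTmul H.p = _
  rw [← G.of_galR, h]

theorem mem_ccLeft_iff {f : A} : f ∈ H.ccLeft ↔ G.galRL (f ⊗ₜ H.p) = H.p ⊗ₜ f := by
  refine ⟨fun h => G.of_injective ((G.of_galRL f H.p).trans h), fun h => ?_⟩
  change G.comul f * tmulOne H.p = _
  rw [← G.of_galRL, h]

/-- `z ↦ Δ(z)(1 ⊗ p) - z ⊗ p`, with kernel `c_c(𝔾/ℍ)`. -/
noncomputable def ccDefect : A →ₗ[ℂ] A ⊗[ℂ] A :=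
  G.coR H.p - (TensorProduct.mk ℂ A A).flip H.p

theorem mem_cc_iff_ccDefect {f : A} : f ∈ H.cc ↔ H.ccDefect f = 0 := by
  rw [mem_cc_iff, ← sub_eq_zero]
  rfl

/-- The inverse of `x ⊗ y ↦ Δ(x)(y ⊗ 1)` maps `A ⊗ c_c(𝔾/ℍ)` to `c_c(𝔾/ℍ) ⊗ A`. -/
theorem rTensor_ccDefect {e h : A} (hh : h ∈ H.cc) :
    H.ccDefect.rTensor A (G.galRL.symm (e ⊗ₜ h)) = 0 := by
  -- After this bijection the defect acts on the second leg of `e ⊗ h`, where it vanishes because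
  -- `h` is right invariant.
  apply G.galRLFst.injective
  have h₁ := G.lTensor_coR_galRL' H.p (G.galRL.symm (e ⊗ₜ h))
  have h₂ := G.lTensor_mk_galRL H.p (G.galRL.symm (e ⊗ₜ h))
  rw [LinearEquiv.apply_symm_apply] at h₁ h₂
  rw [ccDefect, LinearMap.rTensor_sub, LinearMap.sub_apply, map_sub, ← h₁, ← h₂, map_zero,
    LinearMap.lTensor_tmul, LinearMap.lTensor_tmul, G.coR_apply, H.mem_cc_iff.1 hh]
  simp

theorem conv_mem_cc (f : A) {g : A} (hg : g ∈ H.cc) : G.conv f g ∈ H.cc := by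
  rw [mem_cc_iff_ccDefect]
  have e : ∀ t : A ⊗[ℂ] A, H.ccDefect (sliceRight G.φ t) =
      TensorProduct.rid ℂ (A ⊗[ℂ] A) (G.φ.lTensor (A ⊗[ℂ] A) (H.ccDefect.rTensor A t)) := by
    intro t
    induction t using TensorProduct.induction_on with
    | zero => simp
    | add x y hx hy => simp only [map_add, hx, hy]
    | tmul x y => simp
  rw [conv, e, H.rTensor_ccDefect hg]
  simp

/-- For `h ∈ c_c(𝔾/ℍ)` one has `Δ(p)(1 ⊗ h) = Δ(p)(b ⊗ 1)` with `b = (id ⊗ φ)(Δ(p)(1 ⊗ h))`. -/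
theorem galR_p_eq (hφ : G.φ H.p = 1) {h : A} (hh : h ∈ H.cc) :
    G.galR (H.p ⊗ₜ h) = G.galRL (H.p ⊗ₜ sliceRight G.φ (G.galR (H.p ⊗ₜ h))) := by
  have : Nontrivial A := ⟨⟨H.p, 0, H.p_ne_zero⟩⟩
  obtain ⟨ε, hε⟩ := G.exists_counit
  apply G.eq_of_ract_tmulOne
  intro e
  set t := G.galRL.symm (e ⊗ₜ[ℂ] h) with ht
  -- The first leg of `t` lies in `c_c(𝔾/ℍ)`, where `px = ε(x)p`: undo `Δ(x)(1 ⊗ p) = x ⊗ p` and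
  -- multiply the legs, using that `p` is central.
  have h₁ : (LinearMap.mulLeft ℂ H.p).rTensor A t = H.p ⊗ₜ sliceLeft ε t := by
    have e₁ : ∀ t : A ⊗[ℂ] A, (LinearMap.mulLeft ℂ H.p).rTensor A t - H.p ⊗ₜ sliceLeft ε t =
        (LinearMap.mul' ℂ A ∘ₗ G.galR.symm.toLinearMap).rTensor A (H.ccDefect.rTensor A t) := by
      intro t
      induction t using TensorProduct.induction_on with
      | zero => simp
      | add x y hx hy =>
        rw [map_add, map_add, map_add, map_add, ← hx, ← hy, TensorProduct.tmul_add]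
        abel
      | tmul x y =>
        simp [ccDefect, hε, H.p_central, TensorProduct.smul_tmul]
    rw [← sub_eq_zero, e₁, H.rTensor_ccDefect hh, map_zero]
  have h₂ : (tmulOne e).ract (G.galR (H.p ⊗ₜ h)) = G.galRL (H.p ⊗ₜ sliceLeft ε t) := by
    rw [G.ract_tmulOne_galR, ← h₁, ← G.comul_lact_galRL, ht, LinearEquiv.apply_symm_apply]
  -- Left invariance and `φ(p) = 1` identify `(ε ⊗ id)t` with `be`, where `b` is the claimed
  -- element. The auxiliary `e` then cancels.
  have h₃ := congrArg (sliceRight G.φ) h₂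
  rw [sliceRight_ract_tmulOne, φ_invariant', hφ, one_smul] at h₃
  rw [h₂, G.ract_tmulOne_galRL, h₃]

/-- For `h = p` the element `b` of `galR_p_eq` is `p` itself, so the one-sided condition on `p`
yields the other side. -/
theorem galRL_p_p (hφ : G.φ H.p = 1) : G.galRL (H.p ⊗ₜ H.p) = H.p ⊗ₜ H.p := by
  have h := H.galR_p_eq hφ H.p_mem_cc
  rw [H.mem_cc_iff.1 H.p_mem_cc, sliceRight_tmul, hφ, one_smul] at h
  exact h.symm

theorem p_mem_hecke (hφ : G.φ H.p = 1) : H.p ∈ H.hecke :=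
  ⟨H.p_mem_cc, H.mem_ccLeft_iff.2 (H.galRL_p_p hφ)⟩

/-- The module `c_c(𝔾/ℍ)` over `𝒟(𝔾)` is generated by `p`. -/
theorem exists_act_p (hφ : G.φ H.p = 1) (hψ : G.ψ H.p = 1) {h : A} (hh : h ∈ H.cc) :
    ∃ b, h = G.act b H.p := by
  obtain ⟨b, hb⟩ := G.exists_act_eq (sliceRight G.φ (G.galR (H.p ⊗ₜ h)))
  refine ⟨b, ?_⟩
  rw [← hb, ← H.galR_p_eq hφ hh, G.ψ_invariant, hψ, one_smul]

theorem conv_p_left (hφ : G.φ H.p = 1) {f : A} (hf : f ∈ H.ccLeft) : G.conv H.p f = f := by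
  rw [conv, ← H.mem_ccLeft_iff.1 hf, LinearEquiv.symm_apply_apply, sliceRight_tmul, hφ, one_smul]

/-- Equivariance of right convolution by `p` and cyclicity reduce this to `p * p = p`. -/
theorem conv_p_right (hφ : G.φ H.p = 1) (hψ : G.ψ H.p = 1) {f : A} (hf : f ∈ H.cc) :
    G.conv f H.p = f := by
  obtain ⟨b, rfl⟩ := H.exists_act_p hφ hψ hf
  rw [← act_conv, H.conv_p_left hφ (H.p_mem_hecke hφ).2]

/-- `(ψ ⊗ id)(Δ(k)(p ⊗ 1))` is left invariant under `ℍ`. -/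
theorem sliceLeft_galRL_p_mem_ccLeft (k : A) : sliceLeft G.ψ (G.galRL (k ⊗ₜ H.p)) ∈ H.ccLeft := by
  -- Since `Δ(p)(1 ⊗ p) = p ⊗ p`, the covering factor becomes `p ⊗ p`. Applying `ψ` to the first leg
  -- then collapses the other side by right invariance.
  have h := G.assoc_rTensor_galRL (G.coR H.p) (fun m y => G.galR_mul m y H.p) k H.p
  rw [G.coR_apply, H.mem_cc_iff.1 H.p_mem_cc] at h
  rw [mem_ccLeft_iff, ← G.sliceLeft_comulTwo, ← h]
  generalize G.galRL (k ⊗ₜ[ℂ] H.p) = t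
  induction t using TensorProduct.induction_on with
  | zero => simp
  | add x y hx hy => simp only [map_add, TensorProduct.tmul_add, hx, hy]
  | tmul x y =>
    rw [LinearMap.rTensor_tmul, sliceLeft_assoc_tmul, G.coR_apply, G.ψ_invariant, sliceLeft_tmul,
      TensorProduct.smul_tmul]

/-! ### Equivariant endomorphisms and the Hecke algebra -/

theorem mem_endG_iff {F : Module.End ℂ H.cc} :
    F ∈ H.endG ↔ ∀ (b : A) (h : H.cc), (F (H.actCC b h) : A) = G.act b (F h) := by
  rw [endG, Subalgebra.mem_centralizer_iff, Set.forall_mem_range]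
  refine forall_congr' fun b => ⟨fun h x => ?_, fun h => LinearMap.ext fun x => Subtype.ext ?_⟩
  · exact congrArg Subtype.val (LinearMap.congr_fun h x).symm
  · exact (h x).symm

/-- A `𝒟(𝔾)`-linear endomorphism of `c_c(𝔾/ℍ)` maps `p` into the Hecke algebra. -/
theorem apply_p_mem_hecke (hφ : G.φ H.p = 1) (hψ : G.ψ H.p = 1) (F : H.endG) :
    (F.1 ⟨H.p, H.p_mem_cc⟩ : A) ∈ H.hecke := by
  refine ⟨Subtype.property _, ?_⟩
  -- This `b` represents `ψ(· p)`, which fixes `p` because `Δ(p)(p ⊗ 1) = p ⊗ p` and `ψ(p) = 1`.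
  obtain ⟨b, hb⟩ := G.exists_act_eq H.p
  have hp : H.actCC b ⟨H.p, H.p_mem_cc⟩ = ⟨H.p, H.p_mem_cc⟩ := by
    apply Subtype.ext
    change G.act b H.p = H.p
    rw [← hb, H.galRL_p_p hφ, sliceLeft_tmul, hψ, one_smul]
  have h := H.mem_endG_iff.1 F.2 b ⟨H.p, H.p_mem_cc⟩
  rw [hp, ← hb] at h
  rw [h]
  exact H.sliceLeft_galRL_p_mem_ccLeft _

/-- A `𝒟(𝔾)`-linear endomorphism of `c_c(𝔾/ℍ)` is determined by its value at `p`. -/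
theorem endG_ext (hφ : G.φ H.p = 1) (hψ : G.ψ H.p = 1) {F F' : H.endG}
    (h : (F.1 ⟨H.p, H.p_mem_cc⟩ : A) = F'.1 ⟨H.p, H.p_mem_cc⟩) : F = F' := by
  refine Subtype.ext (LinearMap.ext fun x => Subtype.ext ?_)
  obtain ⟨b, hb⟩ := H.exists_act_p hφ hψ x.2
  have hx : x = H.actCC b ⟨H.p, H.p_mem_cc⟩ := Subtype.ext hb
  rw [hx, H.mem_endG_iff.1 F.2, H.mem_endG_iff.1 F'.2, h]

/-- Convolution from the right by `f ∈ ℋ(𝔾, ℍ)`, as an element of `End_𝔾(c_c(𝔾/ℍ))`. -/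
noncomputable def convRight : H.hecke →ₗ[ℂ] H.endG where
  toFun f := ⟨(G.convLin.flip f).restrict fun h _ => H.conv_mem_cc h f.2.1,
    H.mem_endG_iff.2 fun b h => (G.act_conv b h f).symm⟩
  map_add' f g := by
    refine Subtype.ext (LinearMap.ext fun x => Subtype.ext ?_)
    exact map_add (G.convLin x) (f : A) g
  map_smul' r f := by
    refine Subtype.ext (LinearMap.ext fun x => Subtype.ext ?_)
    exact map_smul (G.convLin x) r (f : A)

theorem convRight_apply (f : H.hecke) (h : H.cc) :
    ((H.convRight f).1 h : A) = G.conv (h : A) (f : A) := rfl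

theorem convRight_apply_p (hφ : G.φ H.p = 1) (f : H.hecke) :
    ((H.convRight f).1 ⟨H.p, H.p_mem_cc⟩ : A) = f :=
  H.conv_p_left hφ f.2.2

/-- The isomorphism of `ℋ(𝔾, ℍ)` with `End_𝔾(c_c(𝔾/ℍ))`. -/
noncomputable def convRightEquiv (hφ : G.φ H.p = 1) (hψ : G.ψ H.p = 1) : H.hecke ≃ₗ[ℂ] H.endG :=
  { H.convRight with
    invFun := fun F => ⟨F.1 ⟨H.p, H.p_mem_cc⟩, H.apply_p_mem_hecke hφ hψ F⟩
    left_inv := fun f => Subtype.ext (H.convRight_apply_p hφ f)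
    right_inv := fun _ => H.endG_ext hφ hψ (H.convRight_apply_p hφ _) }

/-- `f * g` is the value at `p` of a composite of two equivariant endomorphisms, so left invariance
needs no separate computation. -/
theorem conv_mem_hecke (hφ : G.φ H.p = 1) (hψ : G.ψ H.p = 1) (f g : H.hecke) :
    G.conv f g ∈ H.hecke := by
  have h := H.apply_p_mem_hecke hφ hψ (H.convRight g * H.convRight f)
  change G.conv ((H.convRight f).1 ⟨H.p, H.p_mem_cc⟩ : A) g ∈ H.hecke at h
  rwa [H.convRight_apply_p hφ] at h

theorem convRight_conv (hφ : G.φ H.p = 1) (hψ : G.ψ H.p = 1) (f g : H.hecke) :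
    H.convRight ⟨G.conv f g, H.conv_mem_hecke hφ hψ f g⟩ = H.convRight g * H.convRight f := by
  apply H.endG_ext hφ hψ
  rw [H.convRight_apply_p hφ]
  change _ = G.conv ((H.convRight f).1 ⟨H.p, H.p_mem_cc⟩ : A) g
  rw [H.convRight_apply_p hφ]

end CompactOpenSubgroup

end AlgebraicQuantumGroup

end HeckeAlgebra

end AlgQG

theorem mainTheorem8 {A : Type*} [NonUnitalRing A] [Module ℂ A] [IsScalarTower ℂ A A]
    [SMulCommClass ℂ A A] [StarRing A] [StarModule ℂ A]
    (G : AlgQG.AlgebraicQuantumGroup A) (H : G.CompactOpenSubgroup)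
    (hφ : G.φ H.p = 1) (hψ : G.ψ H.p = 1) :
    ∃ (hmul : ∀ f ∈ H.hecke, ∀ g ∈ H.hecke, G.conv f g ∈ H.hecke) (hp : H.p ∈ H.hecke),
      (∀ f ∈ H.hecke, ∀ g ∈ H.hecke, ∀ k ∈ H.hecke,
        G.conv (G.conv f g) k = G.conv f (G.conv g k)) ∧
      (∀ f ∈ H.hecke, G.conv H.p f = f ∧ G.conv f H.p = f) ∧
      ∃ T : H.hecke ≃ₗ[ℂ] H.endG,
        (∀ (f : H.hecke) (h : H.cc), ((T f).1 h : A) = G.conv (h : A) (f : A)) ∧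
        (∀ F : H.endG, (T.symm F : A) = (F.1 ⟨H.p, H.p_mem_cc⟩ : A)) ∧
        (∀ f g : H.hecke, T ⟨G.conv f g, hmul f f.2 g g.2⟩ = T g * T f) ∧
        T ⟨H.p, hp⟩ = 1 := by
  refine ⟨fun f hf g hg => H.conv_mem_hecke hφ hψ ⟨f, hf⟩ ⟨g, hg⟩, H.p_mem_hecke hφ, ?_,
    fun f hf => ⟨H.conv_p_left hφ hf.2, H.conv_p_right hφ hψ hf.1⟩,
    H.convRightEquiv hφ hψ, H.convRight_apply, fun _ => rfl, H.convRight_conv hφ hψ, ?_⟩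
  · intro f hf g hg k hk
    -- Associativity is `T(g * k) = T(k) ∘ T(g)` evaluated at `f`.
    have h := congrArg (fun F => (F.1 ⟨f, hf.1⟩ : A)) (H.convRight_conv hφ hψ ⟨g, hg⟩ ⟨k, hk⟩)
    exact h.symm
  · exact H.endG_ext hφ hψ (H.convRight_apply_p hφ ⟨H.p, H.p_mem_hecke hφ⟩)
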